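/- Fix a latent dimension $d\ge 1$. Let $n$ nodes have latent positions $x_{it}\in\mathbb R^d$ ($1\le i\le n$, $1\le t\le T$), write $\mathcal X=(x_{it})$, and suppose that the data $\mathcal Y=(Y_{ijt})_{1\le i\neq j\le n,\,1\le t\le T}$ (one observation for each ordered pair of distinct nodes and each time) are independent under the law $P_{\mathcal X}$, with either (G) $Y_{ijt}\sim\mathcal N(x_{it}'x_{jt},\sigma^2)$ for a fixed known $\sigma>0$, or (B) $Y_{ijt}\sim\mathrm{Bernoulli}\big(1/\{1+\exp(-x_{it}'x_{jt})\}\big)$. For $L\ge 0$ let $$\mathrm{PWD}(L)=\Big\{\mathcal X:\ \sum_{t=2}^{T}\sum_{i=1}^{n}\|x_{it}-x_{i(t-1)}\|_2\le L\Big\}.$$ Then in each of the two models there is a constant $c>0$, depending only on $d$ (and on $\sigma$ in model (G)), such that for all $n$, $T$ and $L\ge 0$ with $n-d+1\ge 16$, $n\ge 2d$ and $T\ge 4$, $$\inf_{\hat{\mathcal X}}\ \sup_{\mathcal X\in\mathrm{PWD}(L)}\ \mathbb E_{\mathcal X}\Big[\frac{1}{Tn(n-1)}\sum_{t=1}^{T}\sum_{1\le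 i\neq j\le n}\big(\hat x_{it}'\hat x_{jt}-x_{it}'x_{jt}\big)^2\Big]\ \ge\ c\left(\min\Big\{\frac{L^{2/3}}{n^{4/3}T^{2/3}},\frac1n\Big\}+\frac{1}{nT}\right),$$ where the infimum is over all estimators $\hat{\mathcal X}=(\hat x_{it})$ with $\hat x_{it}\in\mathbb R^d$, i.e. all measurable functions of the data $\mathcal Y$. -/

import Mathlib

open MeasureTheory ProbabilityTheory
open scoped ENNReal NNReal

namespace DynLatent

/-- A trajectory of latent positions: `X t i` is the position in `ℝ^d` of node `i` at time `t`. -/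
abbrev Positions (n T d : ℕ) : Type := Fin T → Fin n → EuclideanSpace ℝ (Fin d)

/-- The ordered pairs `(i, j)` of distinct nodes. -/
abbrev OffDiag (n : ℕ) : Type := {p : Fin n × Fin n // p.1 ≠ p.2}

/-- The observed data: one real number `Y (t, (i, j))` for each time `t` and each ordered pair of
distinct nodes `(i, j)`. -/
abbrev Data (n T : ℕ) : Type := Fin T × OffDiag n → ℝ

/-- Gaussian edge distribution `N(θ, σ²)`. -/
noncomputable def gaussianEdge (σ : ℝ≥0) (θ : ℝ) : Measure ℝ := gaussianReal θ (σ ^ 2)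

/-- Logistic Bernoulli edge distribution: the value `1` has probability `1 / (1 + exp (-θ))`, and
the value `0` has the remaining probability. -/
noncomputable def bernoulliEdge (θ : ℝ) : Measure ℝ :=
  bernoulliMeasure (1 : ℝ) 0 (unitInterval.sigmoid θ)

/-- The law of the data when the latent positions are `X`: the entries are independent, and entry
`(t, (i, j))` has distribution `edge ⟨x_{it}, x_{jt}⟩`. -/
noncomputable def dataLaw {n T d : ℕ} (edge : ℝ → Measure ℝ) (X : Positions n T d) :
    Measure (Data n T) :=
  Measure.pi fun k => edge (inner ℝ (X k.1 k.2.1.1) (X k.1 k.2.1.2))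

/-- The class of latent trajectories whose summed increment norms are at most `L`
(times are numbered from `0` to `T - 1`). -/
def PWD (n T d : ℕ) (L : ℝ) : Set (Positions n T d) :=
  {X | ∑ t : Fin (T - 1), ∑ i : Fin n,
    ‖X ⟨t.val + 1, by have := t.isLt; omega⟩ i - X ⟨t.val, by have := t.isLt; omega⟩ i‖ ≤ L}

/-- The normalized squared loss on the off-diagonal Gram entries. -/
noncomputable def gramLoss {n T d : ℕ} (Xhat X : Positions n T d) : ℝ :=
  1 / ((T : ℝ) * (n : ℝ) * ((n : ℝ) - 1)) *
    ∑ t : Fin T, ∑ p : OffDiag n,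
      (inner ℝ (Xhat t p.1.1) (Xhat t p.1.2) - inner ℝ (X t p.1.1) (X t p.1.2)) ^ 2

/-- The minimax risk over `PWD n T d L`: infimum over all measurable estimators of the supremum
over the class of the expected loss, as an extended nonnegative real. -/
noncomputable def minimaxGramRisk (edge : ℝ → Measure ℝ) (n T d : ℕ) (L : ℝ) : ℝ≥0∞ :=
  ⨅ (est : Data n T → Positions n T d) (_ : Measurable est),
    ⨆ X ∈ PWD n T d L, ∫⁻ Y, ENNReal.ofReal (gramLoss (est Y) X) ∂(dataLaw edge X)

/-- The rate `min {L^{2/3} n^{-4/3} T^{-2/3}, 1/n} + 1/(nT)`. -/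
noncomputable def rate (n T : ℕ) (L : ℝ) : ℝ :=
  min (L ^ (2 / 3 : ℝ) / ((n : ℝ) ^ (4 / 3 : ℝ) * (T : ℝ) ^ (2 / 3 : ℝ))) (1 / (n : ℝ))
    + 1 / ((n : ℝ) * (T : ℝ))

instance (σ : ℝ≥0) (θ : ℝ) : IsProbabilityMeasure (gaussianEdge σ θ) := by
  unfold gaussianEdge; infer_instance

instance (θ : ℝ) : IsProbabilityMeasure (bernoulliEdge θ) := by
  unfold bernoulliEdge; infer_instance

end DynLatent

/-! The bound is Assouad's argument on a hypercube of rank-one trajectories. Half of the nodes sit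
at the first basis vector `e₁` forever; each other node sits at `0` or `ε e₁`, chosen by one free
bit per time block of length `b`. Since the fixed nodes have coefficient `1`, flipping a bit moves
every fixed-moving Gram entry of that node and block by exactly `ε`, while the squared change summed
over all observations is at most `2nbε²`. With `ε² = 1/(nb)` the Hellinger affinity of the two data
laws stays bounded below, so each such entry costs order `ε²` on average over the cube; these
entries are at least a quarter of all pairs, hence the risk is at least of order `1/(nb)`
(`minimax_cube_bound`).

A path makes at most `T/b` jumps of total size `nε` each, so it lies in the class once `T²n ≤ L²b³`,
or with no jumps at all when `b = T`. The smallest admissible `b` yields both terms of the rate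
together (`exists_blockLength`). The models enter only through `AffinityBound`, which holds for all
real parameters. -/

namespace DynLatent

/-! ### Integrals and densities on finite products -/

section Product

variable {ι : Type*} [Fintype ι] {α : ι → Type*} [∀ i, MeasurableSpace (α i)]

theorem lintegral_pi_prod (μ : ∀ i, Measure (α i)) [∀ i, SigmaFinite (μ i)]
    (f : ∀ i, α i → ℝ≥0∞) (hf : ∀ i, Measurable (f i)) :
    ∫⁻ x, ∏ i, f i (x i) ∂(Measure.pi μ) = ∏ i, ∫⁻ y, f i y ∂(μ i) := by
  classical
  have key : ∀ (s : Finset ι) (x : ∀ i, α i),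
      (∫⋯∫⁻_s, (fun x => ∏ i ∈ s, f i (x i)) ∂μ) x = ∏ i ∈ s, ∫⁻ y, f i y ∂(μ i) := by
    intro s
    induction s using Finset.induction_on with
    | empty => intro x; simp
    | insert j s hj ih =>
      intro x
      have hm : ∀ s : Finset ι, Measurable fun x : ∀ i, α i => ∏ i ∈ s, f i (x i) := fun s =>
        Finset.measurable_prod _ fun i _ => (hf i).comp (measurable_pi_apply i)
      rw [lmarginal_insert' _ (hm _) hj, Finset.prod_insert hj]
      have : (fun x : ∀ i, α i => ∫⁻ y, ∏ i ∈ insert j s, f i (Function.update x j y i) ∂(μ j)) =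
          fun x => (∫⁻ y, f j y ∂(μ j)) * ∏ i ∈ s, f i (x i) := by
        funext x
        rw [← lintegral_mul_const _ (hf j)]
        refine lintegral_congr fun y => ?_
        rw [Finset.prod_insert hj, Function.update_self]
        congr 1
        refine Finset.prod_congr rfl fun i hi => ?_
        rw [Function.update_of_ne]
        rintro rfl
        exact hj hi
      rw [this, ← ih x]
      simp only [lmarginal]
      rw [lintegral_const_mul]
      exact (hm s).comp measurable_updateFinset
  -- The marginal integral needs a base point. If the product space is empty, some factor is empty
  -- and both sides vanish.
  have hne : Nonempty (∀ i, α i) ∨ IsEmpty (∀ i, α i) := (isEmpty_or_nonempty _).symm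
  rcases hne with ⟨⟨x⟩⟩ | h
  · rw [lintegral_eq_lmarginal_univ x]
    exact key Finset.univ x
  · obtain ⟨i, hi⟩ := isEmpty_pi.1 h
    rw [lintegral_of_isEmpty, Finset.prod_eq_zero (Finset.mem_univ i) (lintegral_of_isEmpty _ _)]

theorem pi_withDensity_eq (μ : ∀ i, Measure (α i)) [∀ i, SigmaFinite (μ i)]
    (f : ∀ i, α i → ℝ≥0∞) (hf : ∀ i, Measurable (f i))
    [∀ i, SigmaFinite ((μ i).withDensity (f i))] :
    Measure.pi (fun i => (μ i).withDensity (f i)) =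
      (Measure.pi μ).withDensity fun x => ∏ i, f i (x i) := by
  classical
  refine Measure.pi_eq fun s hs => ?_
  rw [withDensity_apply _ (MeasurableSet.univ_pi hs), ← lintegral_indicator (MeasurableSet.univ_pi hs)]
  have : ∀ x : ∀ i, α i, (Set.univ.pi s).indicator (fun x => ∏ i, f i (x i)) x =
      ∏ i, (s i).indicator (f i) (x i) := by
    intro x
    by_cases hx : x ∈ Set.univ.pi s
    · rw [Set.indicator_of_mem hx]
      exact Finset.prod_congr rfl fun i _ => (Set.indicator_of_mem (hx i trivial) _).symm
    · rw [Set.indicator_of_notMem hx]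
      simp only [Set.mem_univ_pi, not_forall] at hx
      obtain ⟨i, hi⟩ := hx
      exact (Finset.prod_eq_zero (Finset.mem_univ i) (Set.indicator_of_notMem hi _)).symm
  simp_rw [this]
  rw [lintegral_pi_prod μ _ fun i => (hf i).indicator (hs i)]
  refine Finset.prod_congr rfl fun i _ => ?_
  rw [withDensity_apply _ (hs i), lintegral_indicator (hs i)]

end Product

/-! ### The two-point bound in terms of the Hellinger affinity -/

/-- The Hellinger affinity of two densities. -/
noncomputable def affinity {α : Type*} [MeasurableSpace α] (μ : Measure α) (p q : α → ℝ≥0∞) : ℝ≥0∞ :=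
  ∫⁻ x, p x ^ (1 / 2 : ℝ) * q x ^ (1 / 2 : ℝ) ∂μ

theorem add_sq_le_two_mul (a b : ℝ≥0∞) : (a + b) ^ 2 ≤ 2 * (a ^ 2 + b ^ 2) := by
  have h := ENNReal.rpow_add_le_mul_rpow_add_rpow a b (p := 2) (by norm_num)
  norm_num at h
  exact_mod_cast h

/-- Cauchy-Schwarz for `|g|√p` and `√q`, the second of which has unit norm. -/
theorem sq_lintegral_mul_sqrt_le {α : Type*} [MeasurableSpace α] (μ : Measure α) {p q : α → ℝ≥0∞}
    (hp : Measurable p) (hq : Measurable q) (hq1 : ∫⁻ x, q x ∂μ = 1) {g : α → ℝ}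
    (hg : Measurable g) :
    (∫⁻ x, ENNReal.ofReal |g x| * (p x ^ (1 / 2 : ℝ) * q x ^ (1 / 2 : ℝ)) ∂μ) ^ 2 ≤
      ∫⁻ x, ENNReal.ofReal (g x ^ 2) ∂(μ.withDensity p) := by
  have h := ENNReal.lintegral_mul_le_Lp_mul_Lq μ Real.HolderConjugate.two_two
    (f := fun x => ENNReal.ofReal |g x| * p x ^ (1 / 2 : ℝ)) (g := fun x => q x ^ (1 / 2 : ℝ))
    (by fun_prop) (by fun_prop)
  have hs : ∀ y : ℝ≥0∞, (y ^ (1 / 2 : ℝ)) ^ (2 : ℝ) = y := fun y => by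
    rw [← ENNReal.rpow_mul]; norm_num
  have e1 : ∫⁻ x, (ENNReal.ofReal |g x| * p x ^ (1 / 2 : ℝ)) ^ (2 : ℝ) ∂μ =
      ∫⁻ x, ENNReal.ofReal (g x ^ 2) ∂(μ.withDensity p) := by
    rw [lintegral_withDensity_eq_lintegral_mul _ hp (by fun_prop)]
    refine lintegral_congr fun x => ?_
    rw [ENNReal.mul_rpow_of_nonneg _ _ (by norm_num), hs, Pi.mul_apply, mul_comm,
      ENNReal.rpow_two, ← ENNReal.ofReal_pow (abs_nonneg _), sq_abs]
  simp only [Pi.mul_apply] at h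
  rw [e1] at h
  simp only [hs, hq1, ENNReal.one_rpow, mul_one] at h
  calc _ ≤ ((∫⁻ x, ENNReal.ofReal (g x ^ 2) ∂(μ.withDensity p)) ^ (1 / 2 : ℝ)) ^ 2 := by
        gcongr
        simpa only [mul_assoc] using h
    _ = _ := by rw [← ENNReal.rpow_two, hs]

/-- Integrate `|u - v| ≤ |f - u| + |f - v|` against the weight `√(pq)`. No test is extracted from
`f`, so arbitrary real-valued estimators of a Gram entry are covered directly. -/
theorem two_point_bound {α : Type*} [MeasurableSpace α] (μ : Measure α) {p q : α → ℝ≥0∞}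
    (hp : Measurable p) (hq : Measurable q) (hp1 : ∫⁻ x, p x ∂μ = 1) (hq1 : ∫⁻ x, q x ∂μ = 1)
    {f : α → ℝ} (hf : Measurable f) (u v : ℝ) :
    ENNReal.ofReal ((u - v) ^ 2) * affinity μ p q ^ 2 ≤
      2 * (∫⁻ x, ENNReal.ofReal ((f x - u) ^ 2) ∂(μ.withDensity p) +
        ∫⁻ x, ENNReal.ofReal ((f x - v) ^ 2) ∂(μ.withDensity q)) := by
  have h1 := sq_lintegral_mul_sqrt_le μ hp hq hq1 (g := fun x => f x - u) (by fun_prop)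
  have h2 := sq_lintegral_mul_sqrt_le μ hq hp hp1 (g := fun x => f x - v) (by fun_prop)
  refine le_trans ?_ ((add_sq_le_two_mul _ _).trans (mul_le_mul_right (add_le_add h1 h2) 2))
  rw [← sq_abs, ENNReal.ofReal_pow (abs_nonneg _), ← mul_pow]
  gcongr
  rw [affinity, ← lintegral_const_mul _ (by fun_prop), ← lintegral_add_left (by fun_prop)]
  refine lintegral_mono fun x => ?_
  simp only
  rw [mul_comm (q x ^ _), ← add_mul, ← ENNReal.ofReal_add (abs_nonneg _) (abs_nonneg _)]
  gcongr
  calc |u - v| = |(f x - v) - (f x - u)| := by ring_nf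
    _ ≤ _ := (abs_sub _ _).trans_eq (add_comm _ _)

/-! ### Edge families with quadratically decaying affinity -/

/-- The edge distributions are dominated, with densities whose pairwise Hellinger affinity is at
least `exp (-C (θ - θ')²)`. -/
def AffinityBound (edge : ℝ → Measure ℝ) (C : ℝ) : Prop :=
  ∃ (μ : Measure ℝ) (p : ℝ → ℝ → ℝ≥0∞), SigmaFinite μ ∧ (∀ θ, Measurable (p θ)) ∧
    (∀ θ, edge θ = μ.withDensity (p θ)) ∧
    ∀ θ θ', ENNReal.ofReal (Real.exp (-(C * (θ - θ') ^ 2))) ≤ affinity μ (p θ) (p θ')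

/-- Affinity is multiplicative over independent coordinates; squaring it produces the factor `2C`.
-/
theorem two_point_bound_pi {ι : Type*} [Fintype ι] {edge : ℝ → Measure ℝ} {C : ℝ}
    [∀ θ, IsProbabilityMeasure (edge θ)] (hE : AffinityBound edge C) (θ θ' : ι → ℝ)
    {f : (ι → ℝ) → ℝ} (hf : Measurable f) (u v : ℝ) :
    ENNReal.ofReal ((u - v) ^ 2 * Real.exp (-(2 * C * ∑ k, (θ k - θ' k) ^ 2))) ≤
      2 * (∫⁻ x, ENNReal.ofReal ((f x - u) ^ 2) ∂(Measure.pi fun k => edge (θ k)) +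
        ∫⁻ x, ENNReal.ofReal ((f x - v) ^ 2) ∂(Measure.pi fun k => edge (θ' k))) := by
  obtain ⟨μ, p, hμ, hpm, hpe, haff⟩ := hE
  have hprob : ∀ t, IsProbabilityMeasure (μ.withDensity (p t)) := fun t => hpe t ▸ inferInstance
  have hden : ∀ η : ι → ℝ, Measure.pi (fun k => edge (η k)) =
      (Measure.pi fun _ => μ).withDensity fun x => ∏ k, p (η k) (x k) := fun η => by
    simp_rw [hpe]
    exact pi_withDensity_eq _ _ fun k => hpm _
  have hm : ∀ η : ι → ℝ, Measurable fun x : ι → ℝ => ∏ k, p (η k) (x k) := fun η =>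
    Finset.measurable_prod _ fun k _ => (hpm _).comp (measurable_pi_apply k)
  have hone : ∀ η : ι → ℝ, ∫⁻ x, ∏ k, p (η k) (x k) ∂(Measure.pi fun _ => μ) = 1 := fun η => by
    rw [← setLIntegral_univ, ← withDensity_apply _ MeasurableSet.univ, ← hden, measure_univ]
  rw [hden, hden]
  refine le_trans ?_ (two_point_bound _ (hm θ) (hm θ') (hone θ) (hone θ') hf u v)
  rw [ENNReal.ofReal_mul (sq_nonneg _)]
  gcongr
  have haf : affinity (Measure.pi fun _ : ι => μ) (fun x => ∏ k, p (θ k) (x k))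
      (fun x => ∏ k, p (θ' k) (x k)) = ∏ k, affinity μ (p (θ k)) (p (θ' k)) := by
    simp only [affinity]
    rw [← lintegral_pi_prod (fun _ : ι => μ)
      (fun k y => p (θ k) y ^ (1 / 2 : ℝ) * p (θ' k) y ^ (1 / 2 : ℝ))
      (fun k => ((hpm _).pow_const _).mul ((hpm _).pow_const _))]
    refine lintegral_congr fun x => ?_
    rw [Finset.prod_mul_distrib, ENNReal.prod_rpow_of_nonneg (by norm_num),
      ENNReal.prod_rpow_of_nonneg (by norm_num)]
  have hexp : Real.exp (-(2 * C * ∑ k, (θ k - θ' k) ^ 2)) =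
      (∏ k, Real.exp (-(C * (θ k - θ' k) ^ 2))) ^ 2 := by
    rw [← Real.exp_sum, ← Real.exp_nat_mul, Finset.sum_neg_distrib, ← Finset.mul_sum]
    congr 1
    push_cast
    ring
  rw [haf, hexp, ENNReal.ofReal_pow (by positivity),
    ENNReal.ofReal_prod_of_nonneg fun _ _ => (Real.exp_pos _).le]
  gcongr with k
  exact haff _ _

/-- The geometric mean of two normal densities of equal variance is the density centred at the
midpoint times `exp (-(θ - θ')² / (8σ²))`. -/
theorem affinityBound_gaussianEdge {σ : ℝ≥0} (hσ : 0 < σ) :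
    AffinityBound (gaussianEdge σ) (1 / (8 * (σ : ℝ) ^ 2)) := by
  have hv : σ ^ 2 ≠ 0 := by positivity
  have hσ' : (0 : ℝ) < σ := hσ
  refine ⟨volume, fun θ => gaussianPDF θ (σ ^ 2), inferInstance, fun θ => measurable_gaussianPDF _ _,
    fun θ => gaussianReal_of_var_ne_zero θ hv, fun θ θ' => ?_⟩
  have key : ∀ x, gaussianPDF θ (σ ^ 2) x ^ (1 / 2 : ℝ) * gaussianPDF θ' (σ ^ 2) x ^ (1 / 2 : ℝ) =
      ENNReal.ofReal (Real.exp (-(1 / (8 * (σ : ℝ) ^ 2) * (θ - θ') ^ 2))) *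
        gaussianPDF ((θ + θ') / 2) (σ ^ 2) x := by
    intro x
    simp only [gaussianPDF]
    rw [← ENNReal.mul_rpow_of_nonneg _ _ (by norm_num),
      ← ENNReal.ofReal_mul (gaussianPDFReal_nonneg _ _ _),
      ENNReal.ofReal_rpow_of_nonneg (mul_nonneg (gaussianPDFReal_nonneg _ _ _)
        (gaussianPDFReal_nonneg _ _ _)) (by norm_num), ← ENNReal.ofReal_mul (Real.exp_pos _).le]
    congr 1
    rw [← Real.sqrt_eq_rpow, Real.sqrt_eq_iff_mul_self_eq (mul_nonneg (gaussianPDFReal_nonneg _ _ _)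
        (gaussianPDFReal_nonneg _ _ _)) (mul_nonneg (Real.exp_pos _).le
        (gaussianPDFReal_nonneg _ _ _))]
    simp only [gaussianPDFReal]
    have : ∀ a A B D E : ℝ, A + A + (B + B) = D + E →
        (Real.exp A * (a * Real.exp B)) * (Real.exp A * (a * Real.exp B)) =
          a * Real.exp D * (a * Real.exp E) := by
      intro a A B D E h
      have h2 := congrArg Real.exp h
      simp only [Real.exp_add] at h2
      linear_combination a ^ 2 * h2
    refine (this _ _ _ _ _ ?_).symm
    push_cast
    field_simp
    ring
  rw [affinity]
  simp_rw [key]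
  rw [lintegral_const_mul _ (measurable_gaussianPDF _ _), lintegral_gaussianPDF_eq_one _ hv, mul_one]

/-- With `s = (a+b)/4` and `δ = (a-b)/4`, the affinity equals `cosh s / √(cosh (s+δ) cosh (s-δ))`.
The product under the root is `cosh² s cosh² δ - sinh² s sinh² δ`, so the affinity is at least `1 /
cosh δ ≥ exp (-δ²/2)`. -/
theorem exp_neg_sq_le_sigmoid_affinity (a b : ℝ) :
    Real.exp (-(1 / 32 * (a - b) ^ 2)) ≤
      √(Real.sigmoid a) * √(Real.sigmoid b) + √(1 - Real.sigmoid a) * √(1 - Real.sigmoid b) := by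
  have hsig : ∀ x : ℝ, Real.sigmoid x = Real.exp (x / 2) / (2 * Real.cosh (x / 2)) := fun x => by
    rw [Real.sigmoid_def, Real.cosh_eq]
    have : Real.exp (-x) = Real.exp (-(x / 2)) / Real.exp (x / 2) := by
      rw [← Real.exp_sub]; ring_nf
    rw [this]
    have := Real.exp_pos (x / 2)
    field_simp
  have hsig' : ∀ x : ℝ, 1 - Real.sigmoid x = Real.exp (-x / 2) / (2 * Real.cosh (x / 2)) := fun x => by
    rw [← Real.sigmoid_neg, hsig, neg_div, Real.cosh_neg]
  have hA := Real.cosh_pos (a / 2)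
  have hB := Real.cosh_pos (b / 2)
  set D := √(2 * Real.cosh (a / 2)) * √(2 * Real.cosh (b / 2)) with hD
  have hDpos : 0 < D := by positivity
  have hexp : ∀ x : ℝ, √(Real.exp (x / 2)) = Real.exp (x / 4) := fun x => by
    rw [← Real.exp_half]; ring_nf
  have e : √(Real.sigmoid a) * √(Real.sigmoid b) + √(1 - Real.sigmoid a) * √(1 - Real.sigmoid b) =
      2 * Real.cosh ((a + b) / 4) / D := by
    rw [hsig', hsig', hsig, hsig, Real.sqrt_div (Real.exp_pos _).le, Real.sqrt_div (Real.exp_pos _).le,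
      Real.sqrt_div (Real.exp_pos _).le, Real.sqrt_div (Real.exp_pos _).le, hexp, hexp, hexp, hexp,
      div_mul_div_comm, div_mul_div_comm, ← add_div, Real.cosh_eq ((a + b) / 4), ← Real.exp_add,
      ← Real.exp_add, ← hD]
    ring_nf
  have hDle : D ≤ 2 * (Real.cosh ((a + b) / 4) * Real.cosh ((a - b) / 4)) := by
    rw [hD, ← Real.sqrt_mul (by positivity)]
    refine Real.sqrt_le_iff.2 ⟨by positivity, ?_⟩
    have ha : a / 2 = (a + b) / 4 + (a - b) / 4 := by ring
    have hb : b / 2 = (a + b) / 4 - (a - b) / 4 := by ring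
    rw [ha, hb, Real.cosh_add, Real.cosh_sub]
    nlinarith [mul_nonneg (sq_nonneg (Real.sinh ((a + b) / 4))) (sq_nonneg (Real.sinh ((a - b) / 4)))]
  have hc := Real.cosh_le_exp_half_sq ((a - b) / 4)
  have hc' := Real.cosh_pos ((a + b) / 4)
  rw [e, le_div_iff₀ hDpos]
  have : Real.exp (-(1 / 32 * (a - b) ^ 2)) * Real.exp (((a - b) / 4) ^ 2 / 2) = 1 := by
    rw [← Real.exp_add, Real.exp_eq_one_iff]
    ring
  calc _ ≤ Real.exp (-(1 / 32 * (a - b) ^ 2)) *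
        (2 * (Real.cosh ((a + b) / 4) * Real.exp (((a - b) / 4) ^ 2 / 2))) := by
        gcongr
        exact hDle.trans (by gcongr)
    _ = 2 * Real.cosh ((a + b) / 4) := by linear_combination 2 * Real.cosh ((a + b) / 4) * this

theorem affinityBound_bernoulliEdge : AffinityBound bernoulliEdge (1 / 32) := by
  classical
  -- The dominating measure is counting measure on `{0, 1}`, so the value of the density elsewhere
  -- is immaterial.
  refine ⟨Measure.dirac 1 + Measure.dirac 0, fun θ x => if x = 1 then
      ENNReal.ofReal (Real.sigmoid θ) else ENNReal.ofReal (1 - Real.sigmoid θ),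
    inferInstance, fun θ => Measurable.ite (measurableSet_singleton _) measurable_const
      measurable_const, fun θ => ?_, fun θ θ' => ?_⟩
  · ext s hs
    rw [withDensity_apply _ hs, bernoulliEdge, bernoulliMeasure_apply _ hs, Measure.restrict_add,
      lintegral_add_measure, setLIntegral_dirac, setLIntegral_dirac]
    have h1 : ((unitInterval.toNNReal (unitInterval.sigmoid θ) : ℝ≥0) : ℝ≥0∞) =
        ENNReal.ofReal (Real.sigmoid θ) := by
      rw [← ENNReal.ofReal_coe_nnreal]; rfl
    have h2 : ((unitInterval.toNNReal (unitInterval.symm (unitInterval.sigmoid θ)) : ℝ≥0) : ℝ≥0∞) =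
        ENNReal.ofReal (1 - Real.sigmoid θ) := by
      rw [← ENNReal.ofReal_coe_nnreal]; rfl
    rw [h1, h2]
    have h3 : ENNReal.ofReal (Real.sigmoid θ) + ENNReal.ofReal (1 - Real.sigmoid θ) = 1 := by
      rw [← ENNReal.ofReal_add (Real.sigmoid_nonneg _) (sub_nonneg.2 (Real.sigmoid_le_one _))]
      simp
    split_ifs <;> simp_all
  · have hs : ∀ x : ℝ, 0 ≤ x → ENNReal.ofReal x ^ (1 / 2 : ℝ) = ENNReal.ofReal √x := fun x hx => by
      rw [ENNReal.ofReal_rpow_of_nonneg hx (by norm_num), Real.sqrt_eq_rpow]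
    have h0 := Real.sigmoid_nonneg
    have h1 : ∀ x, 0 ≤ 1 - Real.sigmoid x := fun x => sub_nonneg.2 (Real.sigmoid_le_one x)
    rw [affinity, lintegral_add_measure, lintegral_dirac, lintegral_dirac]
    simp only [if_true, zero_ne_one, if_false]
    rw [hs _ (h0 _), hs _ (h0 _), hs _ (h1 _), hs _ (h1 _), ← ENNReal.ofReal_mul (by positivity),
      ← ENNReal.ofReal_mul (by positivity), ← ENNReal.ofReal_add (by positivity) (by positivity)]
    exact ENNReal.ofReal_le_ofReal (exp_neg_sq_le_sigmoid_affinity θ θ')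

/-! ### Trajectories on a line -/

/-- The trajectory whose positions are the multiples `a t i` of the first basis vector. -/
noncomputable def line {n T d : ℕ} (hd : 0 < d) (a : Fin T → Fin n → ℝ) : Positions n T d :=
  fun t i => a t i • EuclideanSpace.single ⟨0, hd⟩ (1 : ℝ)

theorem inner_line {n T d : ℕ} (hd : 0 < d) (a : Fin T → Fin n → ℝ) (t : Fin T) (i j : Fin n) :
    inner ℝ (line hd a t i) (line hd a t j) = a t i * a t j := by
  simp [line, inner_smul_left, inner_smul_right]
  ring

theorem norm_line_sub {n T d : ℕ} (hd : 0 < d) (a : Fin T → Fin n → ℝ) (s t : Fin T) (i : Fin n) :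
    ‖line hd a s i - line hd a t i‖ = |a s i - a t i| := by
  simp [line, ← sub_smul, norm_smul]

/-- The index of the block of length `b` containing `t`. -/
def block {T : ℕ} (b : ℕ) (t : Fin T) : Fin T := ⟨t.val / b, (Nat.div_le_self _ _).trans_lt t.isLt⟩

/-- Coefficients of the hypercube: the first half of the nodes is fixed at `1`, and each of the
remaining nodes is at `0` or `ε` on each block of length `b`, according to the bits `w`. -/
noncomputable def cubeCoeff {n T : ℕ} (ε : ℝ) (b : ℕ) (w : Fin n × Fin T → Bool)
    (t : Fin T) (i : Fin n) : ℝ :=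
  if i.val < n / 2 then 1 else if w (i, block b t) then ε else 0

theorem abs_cubeCoeff_le {n T : ℕ} {ε : ℝ} (h0 : 0 ≤ ε) (h1 : ε ≤ 1) (b : ℕ)
    (w : Fin n × Fin T → Bool) (t : Fin T) (i : Fin n) : |cubeCoeff ε b w t i| ≤ 1 := by
  unfold cubeCoeff
  split_ifs <;> simp [abs_of_nonneg, h0, h1]

theorem abs_cubeCoeff_sub_le {n T : ℕ} {ε : ℝ} (h0 : 0 ≤ ε) (b : ℕ)
    (w w' : Fin n × Fin T → Bool) (s t : Fin T) (i : Fin n) :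
    |cubeCoeff ε b w s i - cubeCoeff ε b w' t i| ≤ ε := by
  unfold cubeCoeff
  split_ifs <;> simp [abs_of_nonneg, h0]

/-- Nodes move only when `⌊t/b⌋` increases, so each step is bounded by `nε` times the increment of
`⌊t/b⌋`, and these increments telescope. -/
theorem line_cubeCoeff_mem_PWD {n T d : ℕ} (hd : 0 < d) {L ε : ℝ} (hL : 0 ≤ L) (hε : 0 ≤ ε) {b : ℕ}
    (hb : 0 < b) (hbT : b = T ∨ T / b * (n * ε) ≤ L) (w : Fin n × Fin T → Bool) :
    line hd (cubeCoeff ε b w) ∈ PWD n T d L := by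
  have hstep : ∀ t : Fin (T - 1), ∑ i : Fin n,
      ‖line hd (cubeCoeff ε b w) ⟨t.val + 1, by have := t.isLt; omega⟩ i -
        line hd (cubeCoeff ε b w) ⟨t.val, by have := t.isLt; omega⟩ i‖ ≤
      ((((t.val + 1) / b : ℕ) : ℝ) - ((t.val / b : ℕ) : ℝ)) * (n * ε) := by
    intro t
    have hmono : t.val / b ≤ (t.val + 1) / b := Nat.div_le_div_right (Nat.le_succ _)
    simp only [norm_line_sub]
    rcases hmono.eq_or_lt with h | h
    · rw [← h, sub_self, zero_mul]
      refine (Finset.sum_eq_zero fun i _ => ?_).le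
      have hblock : block b (⟨t.val + 1, by have := t.isLt; omega⟩ : Fin T) =
          block b ⟨t.val, by have := t.isLt; omega⟩ := Fin.ext h.symm
      rw [cubeCoeff, cubeCoeff, hblock, sub_self, abs_zero]
    · have h1 : (1 : ℝ) ≤ (((t.val + 1) / b : ℕ) : ℝ) - ((t.val / b : ℕ) : ℝ) := by
        have : ((t.val / b : ℕ) : ℝ) + 1 ≤ (((t.val + 1) / b : ℕ) : ℝ) := by exact_mod_cast h
        linarith
      calc _ ≤ ∑ _i : Fin n, ε := Finset.sum_le_sum fun i _ => abs_cubeCoeff_sub_le hε ..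
        _ = 1 * (n * ε) := by simp
        _ ≤ _ := by gcongr
  refine (Finset.sum_le_sum fun t _ => hstep t).trans ?_
  rw [← Finset.sum_mul, Fin.sum_univ_eq_sum_range
    (fun t => (((t + 1) / b : ℕ) : ℝ) - ((t / b : ℕ) : ℝ)),
    Finset.sum_range_sub (fun t => ((t / b : ℕ) : ℝ))]
  simp only [Nat.zero_div, Nat.cast_zero, sub_zero]
  rcases hbT with rfl | h
  -- A single block covers all times: `⌊(T-1)/T⌋ = 0`, so the path is constant and fits any `L ≥ 0`.
  · rw [Nat.div_eq_of_lt (by omega)]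
    simpa using hL
  · refine le_trans ?_ h
    gcongr
    calc (((T - 1) / b : ℕ) : ℝ) ≤ ((T / b : ℕ) : ℝ) := by
          exact_mod_cast Nat.div_le_div_right (Nat.sub_le _ _)
      _ ≤ _ := Nat.cast_div_le

/-- Flip the bit at `k`. -/
def flipBit {κ : Type*} [DecidableEq κ] (k : κ) : Equiv.Perm (κ → Bool) :=
  Function.Involutive.toPerm (fun w => Function.update w k (!w k)) fun w => by simp

theorem flipBit_apply {κ : Type*} [DecidableEq κ] (k : κ) (w : κ → Bool) :
    flipBit k w = Function.update w k (!w k) := rfl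

theorem cubeCoeff_flipBit_of_ne {n T : ℕ} (ε : ℝ) (b : ℕ) (w : Fin n × Fin T → Bool) {j i : Fin n}
    {κ t : Fin T} (h : i = j → block b t ≠ κ) :
    cubeCoeff ε b (flipBit (j, κ) w) t i = cubeCoeff ε b w t i := by
  have : (i, block b t) ≠ (j, κ) := fun h' => h (Prod.ext_iff.1 h').1 (Prod.ext_iff.1 h').2
  simp [cubeCoeff, flipBit_apply, Function.update_of_ne this]

theorem card_block_eq_le {T b : ℕ} (hb : 0 < b) (κ : Fin T) :
    (Finset.univ.filter fun t : Fin T => block b t = κ).card ≤ b := by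
  calc _ ≤ (Finset.Ico (κ.val * b) (κ.val * b + b)).card := by
        refine Finset.card_le_card_of_injOn Fin.val (fun t ht => ?_) Fin.val_injective.injOn
        have h : t.val / b = κ.val := congrArg Fin.val (Finset.mem_filter.1 ht).2
        have h1 := Nat.div_mul_le_self t.val b
        have h2 := Nat.lt_div_mul_add hb (a := t.val)
        rw [h] at h1 h2
        exact Finset.mem_coe.2 (Finset.mem_Ico.2 ⟨h1, h2⟩)
    _ = b := by simp

/-- Only pairs containing `j`, at the at most `b` times of the block `κ`, can change. As the two
nodes of a pair are distinct, just one factor moves, by at most `ε`, and the other is at most `1`.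
-/
theorem sum_sq_flipBit_le {n T : ℕ} {ε : ℝ} (h0 : 0 ≤ ε) (h1 : ε ≤ 1) {b : ℕ} (hb : 0 < b)
    (w : Fin n × Fin T → Bool) (j : Fin n) (κ : Fin T) :
    ∑ k : Fin T × OffDiag n,
      (cubeCoeff ε b w k.1 k.2.1.1 * cubeCoeff ε b w k.1 k.2.1.2 -
        cubeCoeff ε b (flipBit (j, κ) w) k.1 k.2.1.1 *
          cubeCoeff ε b (flipBit (j, κ) w) k.1 k.2.1.2) ^ 2 ≤ 2 * n * b * ε ^ 2 := by
  set g : Fin T → Fin n × Fin n → ℝ := fun t p =>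
    if block b t = κ then ((if p.1 = j then ε ^ 2 else 0) + (if p.2 = j then ε ^ 2 else 0)) else 0
    with hg
  have hg0 : ∀ t p, 0 ≤ g t p := fun t p => by simp only [hg]; positivity
  have hprod : ∀ x x' y : ℝ, |x - x'| ≤ ε → |y| ≤ 1 → (x * y - x' * y) ^ 2 ≤ ε ^ 2 := by
    intro x x' y hx hy
    rw [← sub_mul, ← sq_abs, abs_mul]
    have : |x - x'| * |y| ≤ ε * 1 := by gcongr
    rw [mul_one] at this
    gcongr
  have hle : ∀ (t : Fin T) (p : OffDiag n),
      (cubeCoeff ε b w t p.1.1 * cubeCoeff ε b w t p.1.2 -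
        cubeCoeff ε b (flipBit (j, κ) w) t p.1.1 *
          cubeCoeff ε b (flipBit (j, κ) w) t p.1.2) ^ 2 ≤ g t p.1 := by
    rintro t ⟨⟨i, i'⟩, hne⟩
    dsimp only at hne ⊢
    by_cases ht : block b t = κ
    · by_cases hi : i = j
      · have hi' : i' ≠ j := fun h => hne (hi.trans h.symm)
        rw [cubeCoeff_flipBit_of_ne ε b w (i := i') fun h => absurd h hi']
        simp only [hg, ht, hi, hi', if_true, if_false, add_zero]
        exact hprod _ _ _ (abs_cubeCoeff_sub_le h0 ..) (abs_cubeCoeff_le h0 h1 ..)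
      · rw [cubeCoeff_flipBit_of_ne ε b w (i := i) fun h => absurd h hi]
        by_cases hi' : i' = j
        · simp only [hg, ht, hi, hi', if_true, if_false, zero_add]
          rw [mul_comm, mul_comm (cubeCoeff ε b w t i)]
          exact hprod _ _ _ (abs_cubeCoeff_sub_le h0 ..) (abs_cubeCoeff_le h0 h1 ..)
        · rw [cubeCoeff_flipBit_of_ne ε b w (i := i') fun h => absurd h hi']
          simpa using hg0 t (i, i')
    · rw [cubeCoeff_flipBit_of_ne ε b w fun _ => ht, cubeCoeff_flipBit_of_ne ε b w fun _ => ht]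
      simpa using hg0 t (i, i')
  rw [Fintype.sum_prod_type]
  have hsum : ∀ t, ∑ p : OffDiag n, g t p.1 ≤ if block b t = κ then 2 * n * ε ^ 2 else 0 := by
    intro t
    have h2 : ∑ p : OffDiag n, g t p.1 ≤ ∑ p : Fin n × Fin n, g t p := by
      rw [← Finset.sum_subtype (Finset.univ.filter fun p : Fin n × Fin n => p.1 ≠ p.2) (by simp)
        (g t)]
      exact Finset.sum_le_sum_of_subset_of_nonneg (Finset.subset_univ _) fun p _ _ => hg0 t p
    refine h2.trans (le_of_eq ?_)
    rw [Fintype.sum_prod_type]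
    by_cases ht : block b t = κ
    · simp only [hg, ht, if_true, Finset.sum_add_distrib, Finset.sum_ite_eq', Finset.mem_univ,
        Finset.sum_const, Finset.card_univ, Fintype.card_fin, nsmul_eq_mul]
      rw [Finset.sum_comm]
      simp only [Finset.sum_ite_eq', Finset.mem_univ, if_true, Finset.sum_const, Finset.card_univ,
        Fintype.card_fin, nsmul_eq_mul]
      ring
    · simp [hg, ht]
  calc _ ≤ ∑ t : Fin T, if block b t = κ then 2 * n * ε ^ 2 else 0 :=
        Finset.sum_le_sum fun t _ => (Finset.sum_le_sum fun p _ => hle t p).trans (hsum t)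
    _ = (Finset.univ.filter fun t : Fin T => block b t = κ).card * (2 * n * ε ^ 2) := by
        rw [← Finset.sum_filter, Finset.sum_const, nsmul_eq_mul]
    _ ≤ b * (2 * n * ε ^ 2) := by
        gcongr
        exact card_block_eq_le hb κ
    _ = _ := by ring

/-! ### Assouad's argument -/

/-- Pairs of a fixed node and a moving node. -/
def fixedMoving (n : ℕ) : Fin (n / 2) × Fin (n - n / 2) ↪ OffDiag n where
  toFun q := ⟨(⟨q.1.val, by have := q.1.isLt; omega⟩, ⟨n / 2 + q.2.val, by have := q.2.isLt; omega⟩),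
    fun h => by have := Fin.mk.inj h; have := q.1.isLt; omega⟩
  inj' := by
    rintro ⟨a, b⟩ ⟨a', b'⟩ h
    simp only [Subtype.mk.injEq, Prod.mk.injEq, Fin.mk.injEq, Nat.add_left_cancel_iff] at h
    exact Prod.ext (Fin.ext h.1) (Fin.ext h.2)

theorem sq_cubeCoeff_mul_sub_flipBit {n T : ℕ} (ε : ℝ) (b : ℕ) (w : Fin n × Fin T → Bool) (t : Fin T)
    (q : Fin (n / 2) × Fin (n - n / 2)) :
    (cubeCoeff ε b w t (fixedMoving n q).1.1 * cubeCoeff ε b w t (fixedMoving n q).1.2 -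
      cubeCoeff ε b (flipBit ((fixedMoving n q).1.2, block b t) w) t (fixedMoving n q).1.1 *
        cubeCoeff ε b (flipBit ((fixedMoving n q).1.2, block b t) w) t (fixedMoving n q).1.2) ^ 2 =
      ε ^ 2 := by
  have h1 : (fixedMoving n q).1.1.val < n / 2 := q.1.isLt
  have h2 : ¬ (fixedMoving n q).1.2.val < n / 2 := (Nat.le_add_right (n / 2) q.2.val).not_gt
  simp only [cubeCoeff, h1, h2, if_true, if_false, flipBit_apply, Function.update_self]
  cases w ((fixedMoving n q).1.2, block b t) <;> simp

/-- The supremum dominates the average over all bit strings. The `16` is `4` from the two-point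
bound and the pairing of strings, times `4` from keeping only fixed-moving pairs. -/
theorem minimax_cube_bound {edge : ℝ → Measure ℝ} {C : ℝ} [∀ θ, IsProbabilityMeasure (edge θ)]
    (hE : AffinityBound edge C) (hC : 0 ≤ C) {n T d : ℕ} (hd : 0 < d) (hn : 2 ≤ n) (hT : 0 < T) {L ε : ℝ}
    (hL : 0 ≤ L) (hε : 0 ≤ ε) (hε1 : ε ≤ 1) {b : ℕ} (hb : 0 < b) (hnb : n * b * ε ^ 2 ≤ 1)
    (hbT : b = T ∨ T / b * (n * ε) ≤ L) :
    ENNReal.ofReal (Real.exp (-(4 * C)) * ε ^ 2 / 16) ≤ minimaxGramRisk edge n T d L := by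
  refine le_iInf₂ fun est hest => ?_
  set R := ⨆ X ∈ PWD n T d L, ∫⁻ Y, ENNReal.ofReal (gramLoss (est Y) X) ∂(dataLaw edge X) with hR
  set N := 1 / ((T : ℝ) * (n : ℝ) * ((n : ℝ) - 1)) with hN
  have hn' : (2 : ℝ) ≤ n := by exact_mod_cast hn
  have hT' : (0 : ℝ) < T := by exact_mod_cast hT
  have hN0 : 0 ≤ N := by
    have : (0 : ℝ) ≤ (n : ℝ) - 1 := by linarith
    positivity
  let θ : (Fin n × Fin T → Bool) → Fin T × OffDiag n → ℝ := fun w k =>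
    cubeCoeff ε b w k.1 k.2.1.1 * cubeCoeff ε b w k.1 k.2.1.2
  let f : Fin T × OffDiag n → Data n T → ℝ := fun k Y =>
    inner ℝ (est Y k.1 k.2.1.1) (est Y k.1 k.2.1.2)
  have hf : ∀ k, Measurable (f k) := fun k => by
    have h : ∀ i, Measurable fun Y => est Y k.1 i := fun i =>
      (measurable_pi_apply i).comp ((measurable_pi_apply k.1).comp hest)
    exact (h _).inner (h _)
  let F : (Fin n × Fin T → Bool) → Fin T × OffDiag n → ℝ≥0∞ := fun w k =>
    ∫⁻ Y, ENNReal.ofReal ((f k Y - θ w k) ^ 2) ∂(Measure.pi fun k => edge (θ w k))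
  have hlow : ∀ w, ENNReal.ofReal N * ∑ t, ∑ q, F w (t, fixedMoving n q) ≤ R := by
    intro w
    have hmem := line_cubeCoeff_mem_PWD (n := n) hd hL hε hb hbT w
    refine le_trans ?_ (le_iSup₂ (f := fun X (_ : X ∈ PWD n T d L) =>
      ∫⁻ Y, ENNReal.ofReal (gramLoss (est Y) X) ∂(dataLaw edge X)) _ hmem)
    have hlaw : dataLaw edge (line hd (cubeCoeff ε b w)) = Measure.pi fun k => edge (θ w k) := by
      simp only [dataLaw, inner_line, θ]
    have hm : ∀ k, Measurable fun Y => ENNReal.ofReal ((f k Y - θ w k) ^ 2) := fun k =>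
      (((hf k).sub_const _).pow_const 2).ennreal_ofReal
    simp only [hlaw, F]
    simp_rw [← lintegral_finsetSum _ fun _ _ => hm _]
    rw [← lintegral_finsetSum _ fun _ _ => Finset.measurable_sum _ fun _ _ => hm _,
      ← lintegral_const_mul _ (Finset.measurable_sum _ fun _ _ => Finset.measurable_sum _ fun _ _ => hm _)]
    refine lintegral_mono fun Y => ?_
    simp only [gramLoss, inner_line]
    rw [ENNReal.ofReal_mul hN0, ENNReal.ofReal_sum_of_nonneg fun _ _ =>
      Finset.sum_nonneg fun _ _ => sq_nonneg _]
    gcongr with t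
    rw [ENNReal.ofReal_sum_of_nonneg fun _ _ => sq_nonneg _,
      ← Finset.sum_map Finset.univ (fixedMoving n)
        (fun p => ENNReal.ofReal ((f (t, p) Y - θ w (t, p)) ^ 2))]
    exact Finset.sum_le_sum_of_subset (Finset.subset_univ _)
  -- The exponent is at most `2C · 2nbε² ≤ 4C`.
  have htwo : ∀ w t q, ENNReal.ofReal (Real.exp (-(4 * C)) * ε ^ 2) ≤
      2 * (F w (t, fixedMoving n q) +
        F (flipBit ((fixedMoving n q).1.2, block b t) w) (t, fixedMoving n q)) := by
    intro w t q
    refine le_trans ?_ (two_point_bound_pi hE _ _ (hf (t, fixedMoving n q)) _ _)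
    refine ENNReal.ofReal_le_ofReal ?_
    simp only [θ]
    rw [sq_cubeCoeff_mul_sub_flipBit, mul_comm]
    have hs := sum_sq_flipBit_le hε hε1 hb w (fixedMoving n q).1.2 (block b t)
    refine mul_le_mul_of_nonneg_left (Real.exp_le_exp.2 (neg_le_neg ?_)) (sq_nonneg ε)
    nlinarith
  -- Flipping a bit permutes the cube, so both terms of the two-point bound have the same sum over
  -- `w`.
  have havg : ∀ t q, Fintype.card (Fin n × Fin T → Bool) *
      ENNReal.ofReal (Real.exp (-(4 * C)) * ε ^ 2) ≤ 4 * ∑ w, F w (t, fixedMoving n q) := by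
    intro t q
    calc _ = ∑ _w : Fin n × Fin T → Bool, ENNReal.ofReal (Real.exp (-(4 * C)) * ε ^ 2) := by
          rw [Finset.sum_const, nsmul_eq_mul, Finset.card_univ]
      _ ≤ ∑ w, 2 * (F w (t, fixedMoving n q) +
            F (flipBit ((fixedMoving n q).1.2, block b t) w) (t, fixedMoving n q)) :=
          Finset.sum_le_sum fun w _ => htwo w t q
      _ = _ := by
          rw [← Finset.mul_sum, Finset.sum_add_distrib,
            Equiv.sum_comp (flipBit ((fixedMoving n q).1.2, block b t))
              fun w => F w (t, fixedMoving n q)]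
          ring
  have hcard : 1 ≤ ENNReal.ofReal N * (T * ((n / 2 : ℕ) * (n - n / 2 : ℕ) : ℕ)) * 4 := by
    -- For odd `n = 2m + 1` both sides equal `4m(m+1)`, which is why the constant `4` suffices for
    -- every `n`.
    have hcount : n * (n - 1) ≤ n / 2 * (n - n / 2) * 4 := by
      obtain ⟨m, hm⟩ | ⟨m, hm⟩ := Nat.even_or_odd n
      · have h1 : n / 2 = m := by omega
        have h2 : n - m = m := by omega
        rw [h1, h2]
        calc n * (n - 1) ≤ n * n := Nat.mul_le_mul_left _ (Nat.sub_le _ _)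
          _ = m * m * 4 := by rw [hm]; ring
      · have h1 : n / 2 = m := by omega
        have h2 : n - m = m + 1 := by omega
        have h3 : n - 1 = 2 * m := by omega
        rw [h1, h2, h3, hm]
        nlinarith
    have hcount' : (n : ℝ) * ((n : ℝ) - 1) ≤ ((n / 2 * (n - n / 2) : ℕ) : ℝ) * 4 := by
      have := (Nat.cast_le (α := ℝ)).2 hcount
      rw [Nat.cast_mul, Nat.cast_mul _ 4, Nat.cast_sub (by omega)] at this
      simpa using this
    have e : ENNReal.ofReal N * (T * ((n / 2 : ℕ) * (n - n / 2 : ℕ) : ℕ)) * 4 =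
        ENNReal.ofReal (N * (T * ((n / 2 * (n - n / 2) : ℕ) : ℝ)) * 4) := by
      rw [ENNReal.ofReal_mul (by positivity), ENNReal.ofReal_mul hN0,
        ENNReal.ofReal_mul (by positivity), ENNReal.ofReal_natCast, ENNReal.ofReal_natCast]
      simp
    rw [e, ENNReal.one_le_ofReal, hN, div_mul_eq_mul_div, div_mul_eq_mul_div, one_mul,
      one_le_div (mul_pos (by positivity) (by linarith))]
    calc (T : ℝ) * n * (n - 1) = T * (n * (n - 1)) := by ring
      _ ≤ T * (((n / 2 * (n - n / 2) : ℕ) : ℝ) * 4) := by gcongr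
      _ = _ := by ring
  set K : ℝ≥0∞ := (Fintype.card (Fin n × Fin T → Bool) : ℝ≥0∞) with hK
  set A := ENNReal.ofReal (Real.exp (-(4 * C)) * ε ^ 2) with hA
  have hmain : K * A ≤ K * (16 * R) := by
    calc K * A = 1 * (K * A) := (one_mul _).symm
      _ ≤ (ENNReal.ofReal N * (T * ((n / 2 : ℕ) * (n - n / 2 : ℕ) : ℕ)) * 4) * (K * A) := by gcongr
      _ = 4 * (ENNReal.ofReal N * ∑ _t : Fin T, ∑ _q : Fin (n / 2) × Fin (n - n / 2), K * A) := by
          simp only [Finset.sum_const, Finset.card_univ, Fintype.card_prod, Fintype.card_fin,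
            nsmul_eq_mul]
          ring
      _ ≤ 4 * (ENNReal.ofReal N * ∑ t : Fin T, ∑ q : Fin (n / 2) × Fin (n - n / 2),
            4 * ∑ w, F w (t, fixedMoving n q)) := by
          refine mul_le_mul_right (mul_le_mul_right (Finset.sum_le_sum fun t _ =>
            Finset.sum_le_sum fun q _ => havg t q) _) _
      _ = 16 * ∑ w, ENNReal.ofReal N * ∑ t, ∑ q, F w (t, fixedMoving n q) := by
          have hswap : ∑ w, ∑ t, ∑ q, F w (t, fixedMoving n q) =
              ∑ t, ∑ q, ∑ w, F w (t, fixedMoving n q) :=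
            Finset.sum_comm.trans (Finset.sum_congr rfl fun t _ => Finset.sum_comm)
          simp only [← Finset.mul_sum]
          rw [hswap]
          ring
      _ ≤ 16 * ∑ _w : Fin n × Fin T → Bool, R := by
          gcongr with w
          exact hlow w
      _ = K * (16 * R) := by
          rw [Finset.sum_const, nsmul_eq_mul, Finset.card_univ, ← hK]
          ring
  have hK0 : K ≠ 0 := by simp [hK]
  have hKt : K ≠ ⊤ := ENNReal.natCast_ne_top _
  have h16 := (ENNReal.mul_le_mul_iff_right hK0 hKt).1 hmain
  rw [ENNReal.ofReal_div_of_pos (by norm_num), ← hA]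
  refine ENNReal.div_le_of_le_mul' ?_
  simpa using h16

/-! ### The choice of the block length -/

/-- The second alternative is the squared budget condition `(T/b) n ε ≤ L` at `ε² = 1/(nb)`. Taking
`b` minimal makes the condition fail at `b - 1`, which bounds `L` from above in terms of `b`. -/
theorem exists_blockLength {n T : ℕ} (hn : 0 < n) (hT : 0 < T) {L : ℝ} (hL : 0 ≤ L) :
    ∃ b : ℕ, 0 < b ∧ (b = T ∨ (T : ℝ) ^ 2 * n ≤ L ^ 2 * b ^ 3) ∧ rate n T L ≤ 3 / (n * b) := by
  classical
  have hex : ∃ b : ℕ, 0 < b ∧ (b = T ∨ (T : ℝ) ^ 2 * n ≤ L ^ 2 * b ^ 3) := ⟨T, hT, Or.inl rfl⟩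
  obtain ⟨hb, hbT⟩ := Nat.find_spec hex
  have hmin := fun m => Nat.find_min hex (m := m)
  have hbleT : Nat.find hex ≤ T := Nat.find_min' hex ⟨hT, Or.inl rfl⟩
  generalize Nat.find hex = b at hb hbT hmin hbleT
  refine ⟨b, hb, hbT, ?_⟩
  have hn' : (0 : ℝ) < n := by exact_mod_cast hn
  have hT' : (0 : ℝ) < T := by exact_mod_cast hT
  have hb' : (0 : ℝ) < b := by exact_mod_cast hb
  have hbleT' : (b : ℝ) ≤ T := by exact_mod_cast hbleT
  have h2 : 1 / ((n : ℝ) * T) ≤ 1 / (n * b) := by gcongr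
  have h1 : min (L ^ (2 / 3 : ℝ) / ((n : ℝ) ^ (4 / 3 : ℝ) * (T : ℝ) ^ (2 / 3 : ℝ))) (1 / (n : ℝ)) ≤
      2 / (n * b) := by
    -- When `b = 1` the cap `1/n` of the minimum suffices; otherwise `b - 1 ≥ b/2` is positive and
    -- minimality applies to it.
    rcases (Nat.succ_le_of_lt hb).eq_or_lt with h | h
    · refine (min_le_right _ _).trans ?_
      rw [← h]
      simp only [Nat.succ_eq_add_one, zero_add, Nat.cast_one, mul_one]
      gcongr
      norm_num
    · refine (min_le_left _ _).trans ?_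
      have hfail := hmin (b - 1) (by omega)
      simp only [not_and_or, not_or, not_le] at hfail
      have hlt : L ^ 2 * ((b - 1 : ℕ) : ℝ) ^ 3 < (T : ℝ) ^ 2 * n := by
        rcases hfail with h' | h'
        · omega
        · exact h'.2
      have hhalf : (b : ℝ) / 2 ≤ ((b - 1 : ℕ) : ℝ) := by
        rw [Nat.cast_sub hb, Nat.cast_one]
        have : (2 : ℝ) ≤ b := by exact_mod_cast h
        linarith
      have hlt' : L ^ 2 * ((b : ℝ) / 2) ^ 3 ≤ (T : ℝ) ^ 2 * n :=
        le_trans (by gcongr) hlt.le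
      -- The cube root gives `L^(2/3) · b/2 ≤ T^(2/3) n^(1/3)`, the source of the `2` in `h1`.
      have hr := Real.rpow_le_rpow (by positivity) hlt' (by norm_num : (0 : ℝ) ≤ 1 / 3)
      rw [Real.mul_rpow (by positivity) (by positivity), Real.mul_rpow (by positivity) (by positivity),
        ← Real.rpow_natCast L, ← Real.rpow_natCast (T : ℝ), ← Real.rpow_natCast ((b : ℝ) / 2),
        ← Real.rpow_mul hL, ← Real.rpow_mul hT'.le, ← Real.rpow_mul (by positivity)] at hr
      norm_num at hr
      have hnn : (n : ℝ) ^ (4 / 3 : ℝ) = n * (n : ℝ) ^ (1 / 3 : ℝ) := by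
        rw [← Real.rpow_one_add' hn'.le (by norm_num)]
        norm_num
      rw [hnn, div_le_div_iff₀ (by positivity) (by positivity)]
      calc L ^ (2 / 3 : ℝ) * (n * b) = 2 * n * (L ^ (2 / 3 : ℝ) * (b / 2)) := by ring
        _ ≤ 2 * n * ((T : ℝ) ^ (2 / 3 : ℝ) * (n : ℝ) ^ (1 / 3 : ℝ)) := by gcongr
        _ = _ := by ring
  calc rate n T L ≤ 2 / (n * b) + 1 / (n * b) := add_le_add h1 h2
    _ = 3 / (n * b) := by ring

theorem rate_le_minimaxGramRisk {edge : ℝ → Measure ℝ} {C : ℝ} [∀ θ, IsProbabilityMeasure (edge θ)]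
    (hE : AffinityBound edge C) (hC : 0 ≤ C) {n T d : ℕ} (hd : 0 < d) (hn : 2 ≤ n) (hT : 0 < T)
    {L : ℝ} (hL : 0 ≤ L) :
    ENNReal.ofReal (Real.exp (-(4 * C)) / 48 * rate n T L) ≤ minimaxGramRisk edge n T d L := by
  obtain ⟨b, hb, hbT, hrate⟩ := exists_blockLength (n := n) (by omega) hT hL
  have hn' : (1 : ℝ) ≤ n := by exact_mod_cast (by omega : 1 ≤ n)
  have hb' : (1 : ℝ) ≤ b := by exact_mod_cast hb
  have hnb : (1 : ℝ) ≤ n * b := by nlinarith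
  have hsq : √(1 / ((n : ℝ) * b)) ^ 2 = 1 / (n * b) := Real.sq_sqrt (by positivity)
  -- The choice `ε = 1/√(nb)` makes `nbε² = 1`; the `48` is `16` from the cube bound times `3` from
  -- `rate ≤ 3/(nb)`.
  refine le_trans (ENNReal.ofReal_le_ofReal ?_) (minimax_cube_bound hE hC hd hn hT hL
    (Real.sqrt_nonneg (1 / ((n : ℝ) * b))) ?_ hb ?_ (hbT.imp_right fun h => ?_))
  · rw [hsq]
    calc _ ≤ Real.exp (-(4 * C)) / 48 * (3 / (n * b)) := by gcongr
      _ = _ := by ring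
  · exact Real.sqrt_le_one.2 ((div_le_one (by positivity)).2 hnb)
  · rw [hsq, mul_one_div_cancel (by positivity)]
  · refine abs_le_of_sq_le_sq' ?_ hL |>.2
    rw [mul_pow, mul_pow, hsq, div_pow, div_mul_eq_mul_div, div_le_iff₀ (by positivity)]
    have : (T : ℝ) ^ 2 * ((n : ℝ) ^ 2 * (1 / (n * b))) = (T : ℝ) ^ 2 * n / b := by field_simp
    rw [this, div_le_iff₀ (by positivity)]
    linarith

end DynLatent

theorem theorem1 (d : ℕ) (hd : 1 ≤ d) :
    (∀ σ : ℝ≥0, 0 < σ → ∃ c : ℝ, 0 < c ∧ ∀ (n T : ℕ) (L : ℝ),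
      16 ≤ n - d + 1 → 2 * d ≤ n → 4 ≤ T → 0 ≤ L →
        ENNReal.ofReal (c * DynLatent.rate n T L) ≤
          DynLatent.minimaxGramRisk (DynLatent.gaussianEdge σ) n T d L) ∧
    (∃ c : ℝ, 0 < c ∧ ∀ (n T : ℕ) (L : ℝ),
      16 ≤ n - d + 1 → 2 * d ≤ n → 4 ≤ T → 0 ≤ L →
        ENNReal.ofReal (c * DynLatent.rate n T L) ≤
          DynLatent.minimaxGramRisk DynLatent.bernoulliEdge n T d L) :=
  ⟨fun σ hσ => ⟨Real.exp (-(4 * (1 / (8 * (σ : ℝ) ^ 2)))) / 48, by positivity,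
      fun _ _ _ _ hn hT hL => DynLatent.rate_le_minimaxGramRisk
        (DynLatent.affinityBound_gaussianEdge hσ) (by positivity) hd (by omega) (by omega) hL⟩,
    Real.exp (-(4 * (1 / 32))) / 48, by positivity,
      fun _ _ _ _ hn hT hL => DynLatent.rate_le_minimaxGramRisk
        DynLatent.affinityBound_bernoulliEdge (by norm_num) hd (by omega) (by omega) hL⟩
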